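/- Let $r=(r_n)$, $s=(s_n)$, $t=(t_n)$, $n\ge 0$, be sequences of real (or of complex) numbers with $r_n\neq0$, $t_n\ne0$ for all $n$ and $s_0\neq 0$, and let $p=(p_k)_{k\ge0}$ be a bounded sequence of strictly positive real numbers. Put $\Delta x_k=x_k-x_{k-1}$ with $x_{-1}=0$ and $$l(r,s,t,p;\Delta)=\Big\{x=(x_k)_{k\ge 0}:\ \sum_{n=0}^\infty\Big|\frac1{r_n}\sum_{k=0}^n s_{n-k}t_k\,\Delta x_k\Big|^{p_n}<\infty\Big\}.$$ Its $\beta$-dual $[l(r,s,t,p;\Delta)]^\beta$ is the set of all sequences $a=(a_k)$ such that $\sum_k a_kx_k$ converges for every $x\in l(r,s,t,p;\Delta)$. For an infinite matrix $A=(a_{nk})_{n,k\ge0}$ write $A\in(l(r,s,t,p;\Delta),l_1)$ if for every $x\in l(r,s,t,p;\Delta)$ all the series $(Ax)_n=\sum_k a_{nk}x_k$ converge and $\sum_n|(Ax)_n|<\infty$. Let $D^{(s)}_0=1/s_0$ and, for $n\ge1$, let $D_n^{(s)}=s_0^{-(n+1)}\det\big(s_{i-j+1}\big)_{1\le i,j\le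 n}$, where $s_m=0$ for $m<0$. For a sequence $a=(a_k)$ let $E(a)=(e_{mk})_{m,k\ge0}$, where $e_{mk}=0$ for $k>m$ and, for $0\le k\le m$, $$e_{mk}=r_k\Big[\frac{a_k}{s_0t_k}+\Big(\frac{D_0^{(s)}}{t_k}-\frac{D_1^{(s)}}{t_{k+1}}\Big)\sum_{j=k+1}^m a_j+\sum_{l=k+2}^m(-1)^{l-k}\frac{D_{l-k}^{(s)}}{t_l}\sum_{j=l}^m a_j\Big].$$ For a matrix $A$ let $\tilde e_{nk}=\lim_{m\to\infty}e^{(n)}_{mk}$, where $(e^{(n)}_{mk})_{m,k}=E\big((a_{nj})_{j}\big)$ is built from the $n$-th row of $A$; by the descriptions of the $\beta$-dual below, this limit exists if that row lies in $[l(r,s,t,p;\Delta)]^\beta$. Below, $F$ ranges over the finite subsets of $\{0,1,2,\dots\}$, and $\mathbb N=\{1,2,\dots\}$. Consider the conditions on a sequence $a$, with $(e_{mk})=E(a)$: * $(B_3)$ $\sup_k|r_ka_k/t_k|^{p_k}<\infty$; * $(B_4)$ $\sup_m\sum_k|e_{mk}L^{-1}|^{p_k'}<\infty$ for some $L\in\mathbb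 N$, where $p_k'=p_k/(p_k-1)$ (used only if all $p_k>1$); * $(B_5)$ $\sup_{m,k}|e_{mk}|^{p_k}<\infty$; * $(B_6)$ $\lim_{m\to\infty}e_{mk}$ exists for every $k$; * $(B_7)$ for every $L\in\mathbb N$ there is a sequence $(\alpha_k)$ with $\sup_{m,k}(|e_{mk}-\alpha_k|L)^{p_k}<\infty$. **(a)** Let $p_k>1$ for all $k$. Then $a\in[l(r,s,t,p;\Delta)]^\beta$ if and only if $a$ satisfies $(B_3)$, $(B_4)$ and $(B_6)$. Moreover $A\in(l(r,s,t,p;\Delta),l_1)$ if and only if $$\sup_F\sum_{k=0}^\infty\Big|\sum_{n\in F}\tilde e_{nk}L^{-1}\Big|^{p_k'}<\infty\ \text{ for some }L\in\mathbb N\quad\text{and}\quad (a_{nk})_{k}\in[l(r,s,t,p;\Delta)]^\beta\ \text{ for every }n.$$ **(b)** Let $0<p_k\le1$ for all $k$. Then $a\in[l(r,s,t,p;\Delta)]^\beta$ if and only if $a$ satisfies $(B_3)$, $(B_5)$, $(B_6)$ and $(B_7)$. Moreover $A\in(l(r,s,t,p;\Delta),l_1)$ if and only if $$\sup_F\sup_k\Big|\sum_{n\in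 F}\tilde e_{nk}\Big|^{p_k}<\infty\quad\text{and}\quad (a_{nk})_{k}\in[l(r,s,t,p;\Delta)]^\beta\ \text{ for every }n.$$ -/

import Mathlib

open Filter Topology

namespace GenMeans

noncomputable section

variable {𝕜 : Type*} [RCLike 𝕜]

/-- The Maddox space `l(p)`. -/
def maddoxL (p : ℕ → ℝ) : Set (ℕ → 𝕜) :=
  {x | Summable fun k => ‖x k‖ ^ p k}

/-- The Maddox space `l_∞(p)`. -/
def maddoxLinf (p : ℕ → ℝ) : Set (ℕ → 𝕜) :=
  {x | (⨆ k, ENNReal.ofReal (‖x k‖ ^ p k)) < ⊤}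

/-- The space `l₁` of absolutely summable sequences. -/
def ell1 : Set (ℕ → 𝕜) :=
  {x | Summable fun k => ‖x k‖}

/-- The series `∑_{k ≥ 0} x k` converges (possibly conditionally) to `v`. -/
def SeriesConvTo (x : ℕ → 𝕜) (v : 𝕜) : Prop :=
  Tendsto (fun m => ∑ k ∈ Finset.range (m + 1), x k) atTop (𝓝 v)

/-- The space `cs` of convergent series. -/
def cs : Set (ℕ → 𝕜) :=
  {x | ∃ v, SeriesConvTo x v}

/-- The `β`-dual of a set of sequences. -/
def betaDual (U : Set (ℕ → 𝕜)) : Set (ℕ → 𝕜) :=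
  {a | ∀ x ∈ U, (fun k => a k * x k) ∈ cs}

/-- The class `(U, V)` of infinite matrices `A` such that for every `x ∈ U` all the series
`(A x)_n = ∑_k a_{nk} x_k` converge and `A x ∈ V`. -/
def matrixClass (U V : Set (ℕ → 𝕜)) : Set (ℕ → ℕ → 𝕜) :=
  {A | ∀ x ∈ U, ∃ z ∈ V, ∀ n, SeriesConvTo (fun k => A n k * x k) (z n)}

/-- The difference operator `(Δ x)_k = x_k - x_{k-1}`, with `x_{-1} = 0`. -/
def diff (x : ℕ → 𝕜) : ℕ → 𝕜
  | 0 => x 0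
  | k + 1 => x (k + 1) - x k

/-- The generalized means `y_n = (1 / r_n) ∑_{k=0}^n s_{n-k} t_k x_k`. -/
def genMean (r s t x : ℕ → 𝕜) (n : ℕ) : 𝕜 :=
  (1 / r n) * ∑ k ∈ Finset.range (n + 1), s (n - k) * t k * x k

/-- The space `l(r, s, t, p; Δ)`. -/
def lSpace (r s t : ℕ → 𝕜) (p : ℕ → ℝ) : Set (ℕ → 𝕜) :=
  {x | genMean r s t (diff x) ∈ maddoxL p}

/-- `D_n^{(s)} = s_0^{-(n+1)}` times the `n × n` determinant with entries `s_{i-j+1}`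
(zero for `j > i + 1`); in particular `D_0^{(s)} = 1 / s_0`. -/
def D (s : ℕ → 𝕜) (n : ℕ) : 𝕜 :=
  (1 / s 0 ^ (n + 1)) *
    (Matrix.of fun i j : Fin n =>
      if (j : ℕ) ≤ (i : ℕ) + 1 then s ((i : ℕ) + 1 - (j : ℕ)) else 0).det

/-- The matrix `E = (e_{mk})` associated with a sequence `a`. -/
def E (r s t a : ℕ → 𝕜) (m k : ℕ) : 𝕜 :=
  if k ≤ m then
    r k * (a k / (s 0 * t k)
      + (D s 0 / t k - D s 1 / t (k + 1)) * ∑ j ∈ Finset.Icc (k + 1) m, a j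
      + ∑ l ∈ Finset.Icc (k + 2) m,
          (-1) ^ (l - k) * (D s (l - k) / t l) * ∑ j ∈ Finset.Icc l m, a j)
  else 0

/-- The matrix `Ẽ = (ẽ_{nk})`, where `ẽ_{nk}` is the limit as `m → ∞` of the entry `e_{mk}` of the
matrix `E` associated with the `n`-th row of `A`. The limit exists whenever that row is in the set
`setB6` below. -/
def Etilde (r s t : ℕ → 𝕜) (A : ℕ → ℕ → 𝕜) (n k : ℕ) : 𝕜 :=
  limUnder atTop fun m => E r s t (A n) m k

/-- The conjugate exponent `p' = p / (p - 1)`, used for `p > 1`. -/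
def conjExp (p : ℝ) : ℝ := p / (p - 1)

def setB3 (r t : ℕ → 𝕜) (p : ℕ → ℝ) : Set (ℕ → 𝕜) :=
  {a | (fun k => r k * a k / t k) ∈ maddoxLinf p}

def setB4 (r s t : ℕ → 𝕜) (p : ℕ → ℝ) : Set (ℕ → 𝕜) :=
  {a | ∃ L : ℕ, 0 < L ∧
    (⨆ m, ∑' k, ENNReal.ofReal (‖E r s t a m k * (L : 𝕜)⁻¹‖ ^ conjExp (p k))) < ⊤}

def setB5 (r s t : ℕ → 𝕜) (p : ℕ → ℝ) : Set (ℕ → 𝕜) :=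
  {a | (⨆ m, ⨆ k, ENNReal.ofReal (‖E r s t a m k‖ ^ p k)) < ⊤}

def setB6 (r s t : ℕ → 𝕜) : Set (ℕ → 𝕜) :=
  {a | ∃ α : ℕ → 𝕜, ∀ k, Tendsto (fun m => E r s t a m k) atTop (𝓝 (α k))}

def setB7 (r s t : ℕ → 𝕜) (p : ℕ → ℝ) : Set (ℕ → 𝕜) :=
  {a | ∀ L : ℕ, 0 < L → ∃ α : ℕ → 𝕜,
    (⨆ m, ⨆ k, ENNReal.ofReal ((‖E r s t a m k - α k‖ * L) ^ p k)) < ⊤}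

end

end GenMeans

/-!
Put `y = genMean r s t (diff x)`; as `x` runs through `l(r, s, t, p; Δ)`, `y` runs through all of
Maddox's space `l(p)`. Inverting the power series `∑ s_k X^k` by Cramer's rule expresses `diff x`
through `y` with the coefficients `(-1)^n D_n`, and a summation by parts gives
`∑_{k ≤ m} a_k x_k = ∑_k e_{mk} y_k`. So `a` lies in the `β`-dual if and only if the functionals
`y ↦ ∑_k e_{mk} y_k` converge pointwise on `l(p)`.

The coordinatewise map `z ↦ |z|^{1/p_k - 1} z` is a homeomorphism of `ℓ¹` onto `l(p)`. It is not
linear, but it makes `l(p)` a Baire space, and adding sequences with disjoint supports is compatible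
with it. This yields a uniform boundedness principle: pointwise convergence on `l(p)` amounts to
equicontinuity at the origin together with convergence of every column. The matrix class into `ℓ¹`
is treated in the same way, with the functionals `∑_{n ∈ F} ẽ_n` indexed by the finite sets `F`.
Finally, equicontinuity on `l(p)` is a boundedness condition on the coefficients, by Young's
inequality if all `p_k > 1` and by `∑ u_k ≤ ∑ u_k^{p_k}` for `0 ≤ u_k ≤ 1` if all `p_k ≤ 1`.
-/

namespace GenMeans

open Finset

section Inversion

/-- The lower triangular Toeplitz matrix of size `n + 1` with first column `s 0, …, s n`; it
represents multiplication by the power series `∑ s k X ^ k` modulo `X ^ (n + 1)`. -/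
def toeplitz {R : Type*} [Zero R] (s : ℕ → R) (n : ℕ) : Matrix (Fin (n + 1)) (Fin (n + 1)) R :=
  Matrix.of fun i j => if (j : ℕ) ≤ i then s (i - j) else 0

lemma det_toeplitz {R : Type*} [CommRing R] (s : ℕ → R) (n : ℕ) :
    (toeplitz s n).det = s 0 ^ (n + 1) := by
  rw [Matrix.det_of_isLowerTriangular]
  · simp [toeplitz]
  · intro i j hij
    exact if_neg (not_le.2 (show (i : ℕ) < j from hij))

lemma sum_range_mul_eq_coeff {R : Type*} [CommSemiring R] (s z : ℕ → R) (n : ℕ) :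
    ∑ k ∈ range (n + 1), s (n - k) * z k =
      PowerSeries.coeff n (PowerSeries.mk s * PowerSeries.mk z) := by
  rw [mul_comm, PowerSeries.coeff_mul, Nat.sum_antidiagonal_eq_sum_range_succ_mk]
  exact sum_congr rfl fun k _ => by simp only [PowerSeries.coeff_mk, mul_comm]

lemma toeplitz_mulVec {R : Type*} [CommRing R] (s c : ℕ → R) {n : ℕ} (i : Fin (n + 1)) :
    (toeplitz s n).mulVec (fun j => c j) i =
      PowerSeries.coeff i (PowerSeries.mk s * PowerSeries.mk c) := by
  have hfilter : (range (n + 1)).filter (fun j : ℕ => j ≤ i) = range (i + 1) := by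
    ext j
    simp only [mem_filter, mem_range]
    omega
  calc ∑ j : Fin (n + 1), (if (j : ℕ) ≤ i then s (i - j) else 0) * c j
      = ∑ j ∈ range (n + 1), if j ≤ i then s (i - j) * c j else 0 := by
        rw [← Fin.sum_univ_eq_sum_range fun j => if j ≤ i then s (i - j) * c j else 0]
        simp only [ite_mul, zero_mul]
    _ = PowerSeries.coeff i (PowerSeries.mk s * PowerSeries.mk c) := by
        rw [← sum_filter, hfilter, sum_range_mul_eq_coeff]

variable {𝕜 : Type*} [RCLike 𝕜] {r s t : ℕ → 𝕜}

lemma adjugate_toeplitz_last_zero (hs : s 0 ≠ 0) (n : ℕ) :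
    (toeplitz s n).adjugate (Fin.last n) 0 = s 0 ^ (n + 1) * ((-1) ^ n * D s n) := by
  have hminor : (toeplitz s n).submatrix (Fin.succAbove 0) (Fin.succAbove (Fin.last n)) =
      Matrix.of fun i j : Fin n => if (j : ℕ) ≤ i + 1 then s (i + 1 - j) else 0 := by
    ext i j
    simp only [toeplitz, Matrix.submatrix_apply, Matrix.of_apply, Fin.succAbove_zero,
      Fin.succAbove_last, Fin.val_succ, Fin.val_castSucc]
  rw [Matrix.adjugate_fin_succ_eq_det_submatrix, hminor, D, mul_left_comm, one_div,
    mul_inv_cancel_left₀ (pow_ne_zero _ hs)]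
  simp only [Fin.val_last, Fin.val_zero, zero_add]

/-- Cramer's rule for the Toeplitz system `s * c = 1`, where `c` is the reciprocal power series. -/
lemma coeff_inv_mk (hs : s 0 ≠ 0) (n : ℕ) :
    PowerSeries.coeff n (PowerSeries.mk s)⁻¹ = (-1) ^ n * D s n := by
  set c : ℕ → 𝕜 := fun k => PowerSeries.coeff k (PowerSeries.mk s)⁻¹
  have hmk : PowerSeries.mk c = (PowerSeries.mk s)⁻¹ :=
    PowerSeries.ext fun k => PowerSeries.coeff_mk k c
  have hc : PowerSeries.mk s * PowerSeries.mk c = 1 := by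
    rw [hmk, PowerSeries.mul_inv_cancel _ (by simpa using hs)]
  have hsystem : (toeplitz s n).mulVec (fun i => c i) = Pi.single 0 1 := by
    ext i
    simp only [toeplitz_mulVec, hc, PowerSeries.coeff_one, Pi.single_apply, Fin.ext_iff,
      Fin.val_zero]
  have hcramer := congrArg (fun v => (toeplitz s n).adjugate.mulVec v (Fin.last n)) hsystem
  simp only [Matrix.mulVec_mulVec, Matrix.adjugate_mul, det_toeplitz, Matrix.smul_mulVec,
    Matrix.one_mulVec, Matrix.mulVec_single_one, Pi.smul_apply, smul_eq_mul, Fin.val_last,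
    Matrix.col_apply, adjugate_toeplitz_last_zero hs] at hcramer
  exact mul_left_cancel₀ (pow_ne_zero _ hs) hcramer

lemma genMean_eq_iff (hr : ∀ n, r n ≠ 0) (hs : s 0 ≠ 0) {y z : ℕ → 𝕜} :
    genMean r s t z = y ↔ PowerSeries.mk (fun k => t k * z k) =
      (PowerSeries.mk s)⁻¹ * PowerSeries.mk fun n => r n * y n := by
  have hs_coeff : PowerSeries.constantCoeff (PowerSeries.mk s) ≠ 0 := by simpa using hs
  rw [mul_comm, PowerSeries.eq_mul_inv_iff_mul_eq hs_coeff, mul_comm, PowerSeries.ext_iff,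
    funext_iff]
  refine forall_congr' fun n => ?_
  simp only [genMean, mul_assoc]
  rw [← sum_range_mul_eq_coeff, PowerSeries.coeff_mk, one_div, inv_mul_eq_iff_eq_mul₀ (hr n)]

lemma eq_sum_genMean (hr : ∀ n, r n ≠ 0) (hs : s 0 ≠ 0) (ht : ∀ n, t n ≠ 0) (z : ℕ → 𝕜) (l : ℕ) :
    z l = ∑ k ∈ range (l + 1),
      (-1) ^ (l - k) * (D s (l - k) / t l) * (r k * genMean r s t z k) := by
  have hcoeff := congrArg (PowerSeries.coeff l) ((genMean_eq_iff (t := t) hr hs (z := z)).1 rfl)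
  have hinv : (PowerSeries.mk s)⁻¹ = PowerSeries.mk fun n => (-1) ^ n * D s n :=
    PowerSeries.ext fun n => by rw [coeff_inv_mk hs, PowerSeries.coeff_mk]
  rw [PowerSeries.coeff_mk, hinv, ← sum_range_mul_eq_coeff] at hcoeff
  rw [← mul_div_cancel_left₀ (z l) (ht l), hcoeff, sum_div]
  exact sum_congr rfl fun k _ => by ring

lemma sum_diff (x : ℕ → 𝕜) (n : ℕ) : ∑ k ∈ range (n + 1), diff x k = x n := by
  induction n with
  | zero => simp [diff]
  | succ n ih => rw [sum_range_succ, ih, diff, add_sub_cancel]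

lemma diff_sum (z : ℕ → 𝕜) : diff (fun n => ∑ k ∈ range (n + 1), z k) = z := by
  ext n
  cases n with
  | zero => simp [diff]
  | succ n => rw [diff, sum_range_succ _ (n + 1), add_sub_cancel_left]

lemma genMean_diff_surjective (hr : ∀ n, r n ≠ 0) (hs : s 0 ≠ 0) (ht : ∀ n, t n ≠ 0) :
    Function.Surjective fun x => genMean r s t (diff x) := by
  intro y
  set w := (PowerSeries.mk s)⁻¹ * PowerSeries.mk fun n => r n * y n
  refine ⟨fun n => ∑ k ∈ range (n + 1), PowerSeries.coeff k w / t k, ?_⟩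
  simp only [diff_sum, genMean_eq_iff hr hs, mul_div_cancel₀ _ (ht _)]
  exact PowerSeries.ext fun n => PowerSeries.coeff_mk n _

lemma D_zero (s : ℕ → 𝕜) : D s 0 = (s 0)⁻¹ := by
  simp [D]

lemma E_eq (r s t a : ℕ → 𝕜) (m k : ℕ) :
    E r s t a m k = r k * ∑ l ∈ Icc k m,
      (-1) ^ (l - k) * (D s (l - k) / t l) * ∑ j ∈ Icc l m, a j := by
  have hsplit : ∀ {i : ℕ} (_ : i ≤ m) (f : ℕ → 𝕜),
      ∑ l ∈ Icc i m, f l = f i + ∑ l ∈ Icc (i + 1) m, f l := fun hi f => by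
    rw [← add_sum_Ioc_eq_sum_Icc hi, Icc_add_one_left_eq_Ioc]
  rcases lt_trichotomy m k with hmk | rfl | hkm
  · simp only [E, hmk.not_ge, if_false, Icc_eq_empty_of_lt hmk, sum_empty, mul_zero]
  · simp only [E, le_refl, if_true, Icc_self, sum_singleton, Nat.sub_self, pow_zero, one_mul,
      D_zero, Icc_eq_empty_of_lt (Nat.lt_succ_self m),
      Icc_eq_empty_of_lt (Nat.lt_add_of_pos_right two_pos),
      sum_empty, mul_zero, add_zero]
    ring
  · rw [E, if_pos hkm.le, hsplit hkm.le (fun l => _ * ∑ j ∈ Icc l m, a j), hsplit hkm.le a,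
      hsplit (i := k + 1) hkm (fun l => _ * ∑ j ∈ Icc l m, a j)]
    simp only [Nat.sub_self, Nat.add_sub_cancel_left, pow_zero, pow_one, D_zero, add_assoc,
      one_add_one_eq_two]
    ring

lemma E_of_lt (r s t a : ℕ → 𝕜) {m k : ℕ} (h : m < k) : E r s t a m k = 0 :=
  if_neg h.not_ge

lemma E_self (r s t a : ℕ → 𝕜) (k : ℕ) : E r s t a k k = (s 0)⁻¹ * (r k * a k / t k) := by
  simp only [E_eq, Icc_self, sum_singleton, Nat.sub_self, D_zero, pow_zero, one_mul]
  ring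

lemma sum_range_sum_range_eq_sum_range_sum_Icc {M : Type*} [AddCommMonoid M] (f : ℕ → ℕ → M)
    (m : ℕ) : ∑ k ∈ range (m + 1), ∑ l ∈ range (k + 1), f k l =
      ∑ l ∈ range (m + 1), ∑ k ∈ Icc l m, f k l :=
  sum_comm' fun k l => by simp only [mem_range, mem_Icc]; omega

lemma sum_mul_eq_sum_E_mul (hr : ∀ n, r n ≠ 0) (hs : s 0 ≠ 0) (ht : ∀ n, t n ≠ 0)
    (a x : ℕ → 𝕜) (m : ℕ) :
    ∑ k ∈ range (m + 1), a k * x k =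
      ∑ k ∈ range (m + 1), E r s t a m k * genMean r s t (diff x) k := by
  set y := genMean r s t (diff x)
  calc ∑ k ∈ range (m + 1), a k * x k
      = ∑ k ∈ range (m + 1), ∑ l ∈ range (k + 1), a k * diff x l := by
        simp only [← mul_sum, sum_diff]
    _ = ∑ l ∈ range (m + 1), (∑ j ∈ Icc l m, a j) * diff x l := by
        simp only [sum_range_sum_range_eq_sum_range_sum_Icc, sum_mul]
    _ = ∑ l ∈ range (m + 1), ∑ k ∈ range (l + 1),
          r k * ((-1) ^ (l - k) * (D s (l - k) / t l) * ∑ j ∈ Icc l m, a j) * y k := by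
        refine sum_congr rfl fun l _ => ?_
        rw [eq_sum_genMean hr hs ht (diff x) l, mul_sum]
        exact sum_congr rfl fun k _ => by ring
    _ = ∑ k ∈ range (m + 1), E r s t a m k * y k := by
        simp only [sum_range_sum_range_eq_sum_range_sum_Icc, E_eq, mul_sum, sum_mul]

lemma sum_mul_eq_tsum_E_mul (hr : ∀ n, r n ≠ 0) (hs : s 0 ≠ 0) (ht : ∀ n, t n ≠ 0)
    (a x : ℕ → 𝕜) (m : ℕ) :
    ∑ k ∈ range (m + 1), a k * x k = ∑' k, E r s t a m k * genMean r s t (diff x) k := by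
  rw [sum_mul_eq_sum_E_mul hr hs ht, tsum_eq_sum fun k hk => ?_]
  rw [E_of_lt r s t a (by simpa using hk), zero_mul]

end Inversion

section Tails

variable {κ V : Type*} [NormedAddCommGroup V] {f : κ → V} {S : Finset κ} {ε : ℝ}

lemma summable_norm_of_tail (h : ∀ T : Finset κ, Disjoint T S → ∑ k ∈ T, ‖f k‖ ≤ ε) :
    Summable fun k => ‖f k‖ := by
  classical
  refine summable_of_sum_le (c := ∑ k ∈ S, ‖f k‖ + ε) (fun _ => norm_nonneg _) fun T => ?_
  rw [← sum_inter_add_sum_sdiff T S]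
  gcongr
  · exact inter_subset_right
  · exact h _ sdiff_disjoint

variable [CompleteSpace V]

lemma norm_tsum_sub_sum_le (h : ∀ T : Finset κ, Disjoint T S → ∑ k ∈ T, ‖f k‖ ≤ ε) :
    ‖∑' k, f k - ∑ k ∈ S, f k‖ ≤ ε := by
  classical
  have hlim : Tendsto (fun T => ‖∑ k ∈ T, f k - ∑ k ∈ S, f k‖) atTop
      (𝓝 ‖∑' k, f k - ∑ k ∈ S, f k‖) :=
    ((summable_norm_of_tail h).of_norm.hasSum.sub_const _).norm
  refine le_of_tendsto hlim ?_
  filter_upwards [eventually_ge_atTop S] with T hT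
  rw [← sum_sdiff hT, add_sub_cancel_right]
  exact (norm_sum_le _ _).trans (h _ sdiff_disjoint)

lemma tendsto_tsum_of_tail {X : Type*} {l : Filter X} [l.NeBot] {f : X → κ → V} {g : κ → V}
    (hfg : ∀ k, Tendsto (f · k) l (𝓝 (g k)))
    (htail : ∀ ε > 0, ∃ S : Finset κ, ∀ᶠ x in l, ∀ T : Finset κ, Disjoint T S →
      ∑ k ∈ T, ‖f x k‖ ≤ ε) :
    Tendsto (fun x => ∑' k, f x k) l (𝓝 (∑' k, g k)) := by
  have hsum : ∀ T : Finset κ, Tendsto (fun x => ∑ k ∈ T, f x k) l (𝓝 (∑ k ∈ T, g k)) :=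
    fun T => tendsto_finsetSum T fun k _ => hfg k
  have hg : Summable g := by
    obtain ⟨S, hS⟩ := htail 1 one_pos
    refine .of_norm (summable_norm_of_tail (S := S) (ε := 1) fun T hT => ?_)
    exact le_of_tendsto (tendsto_finsetSum T fun k _ => (hfg k).norm) (hS.mono fun x hx => hx T hT)
  have hunif : TendstoUniformlyOnFilter (fun (T : Finset κ) x => ∑ k ∈ T, f x k)
      (fun x => ∑' k, f x k) atTop l := by
    refine Metric.tendstoUniformlyOnFilter_iff.2 fun ε hε => ?_
    obtain ⟨S, hS⟩ := htail (ε / 2) (half_pos hε)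
    refine ((eventually_ge_atTop S).prod_mk hS).mono fun q hq => ?_
    rw [dist_eq_norm]
    exact (norm_tsum_sub_sum_le fun T hT => hq.2 T (hT.mono_right hq.1)).trans_lt (half_lt_self hε)
  exact hunif.tendsto_of_eventually_tendsto (Eventually.of_forall hsum) hg.hasSum

end Tails

section AbsoluteSummability

lemma summable_of_abs_sum_le {κ : Type*} {f : κ → ℝ} {B : ℝ}
    (h : ∀ F : Finset κ, |∑ n ∈ F, f n| ≤ B) : Summable f := by
  have hpos : ∀ g : κ → ℝ, (∀ F : Finset κ, |∑ n ∈ F, g n| ≤ B) → Summable fun n => (g n)⁺ := by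
    refine fun g hg => summable_of_sum_le (c := B) (fun n => posPart_nonneg (g n)) fun F => ?_
    calc ∑ n ∈ F, (g n)⁺ = ∑ n ∈ F with 0 ≤ g n, g n := by simp only [sum_filter, posPart_eq_ite]
      _ ≤ B := (le_abs_self _).trans (hg _)
  have hneg := hpos (-f) fun F => by simpa only [Pi.neg_apply, sum_neg_distrib, abs_neg] using h F
  refine ((hpos f h).sub hneg).congr fun n => ?_
  rw [Pi.neg_apply, posPart_neg, posPart_sub_negPart]

lemma mem_ell1_of_norm_sum_le {𝕜 : Type*} [RCLike 𝕜] {z : ℕ → 𝕜} {B : ℝ}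
    (h : ∀ F : Finset ℕ, ‖∑ n ∈ F, z n‖ ≤ B) : z ∈ ell1 := by
  have hre : Summable fun n => RCLike.re (z n) := summable_of_abs_sum_le fun F => by
    rw [← map_sum]
    exact (RCLike.abs_re_le_norm _).trans (h F)
  have him : Summable fun n => RCLike.im (z n) := summable_of_abs_sum_le fun F => by
    rw [← map_sum]
    exact (RCLike.abs_im_le_norm _).trans (h F)
  refine summable_norm_iff.2 ((RCLike.summable_ofReal 𝕜).2 hre |>.add
    (((RCLike.summable_ofReal 𝕜).2 him).mul_right RCLike.I) |>.congr fun n => ?_)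
  exact RCLike.re_add_im (z n)

end AbsoluteSummability

section Equicontinuity

variable {𝕜 : Type*} [RCLike 𝕜] {ι : Type*} {p : ℕ → ℝ} {c : ι → ℕ → 𝕜}

/-- Equicontinuity at the origin of the linear functionals `y ↦ ∑ k, c i k * y k` on `l(p)`. It is
expressed through finite sums of norms, so that it also provides convergence of these series. -/
def EquicontinuousAtZero (p : ℕ → ℝ) (c : ι → ℕ → 𝕜) : Prop :=
  ∀ ε > 0, ∃ ρ > 0, ∀ (i : ι) (S : Finset ℕ) (y : ℕ → 𝕜),
    ∑ k ∈ S, ‖y k‖ ^ p k ≤ ρ → ∑ k ∈ S, ‖c i k * y k‖ ≤ ε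

/-- Rotating the coordinates of `y` does not change `∑ ‖y k‖ ^ p k`, and makes all terms of the sum
`∑ c k * y k` nonnegative. -/
lemma sum_norm_mul_le_of_norm_sum_mul_le {c : ℕ → 𝕜} {S : Finset ℕ} {ρ C : ℝ}
    (h : ∀ y : ℕ → 𝕜, ∑ k ∈ S, ‖y k‖ ^ p k ≤ ρ → ‖∑ k ∈ S, c k * y k‖ ≤ C)
    {y : ℕ → 𝕜} (hy : ∑ k ∈ S, ‖y k‖ ^ p k ≤ ρ) : ∑ k ∈ S, ‖c k * y k‖ ≤ C := by
  choose u hu_norm hu_mul using RCLike.exists_norm_eq_mul_self (K := 𝕜)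
  have hrot : ∀ k, c k * (u (c k * y k) * y k) = (‖c k * y k‖ : ℝ) := fun k => by
    rw [hu_mul, mul_left_comm]
  have hbound := h (fun k => u (c k * y k) * y k) (by simpa only [norm_mul, hu_norm, one_mul])
  simp only [hrot, ← RCLike.ofReal_sum, RCLike.norm_ofReal] at hbound
  exact (le_abs_self _).trans hbound

lemma equicontinuousAtZero_of_norm_sum_le (hpb : BddAbove (Set.range p)) {ρ C : ℝ} (hρ : 0 < ρ)
    (h : ∀ (i : ι) (S : Finset ℕ) (y : ℕ → 𝕜),
      ∑ k ∈ S, ‖y k‖ ^ p k ≤ ρ → ‖∑ k ∈ S, c i k * y k‖ ≤ C) :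
    EquicontinuousAtZero p c := by
  obtain ⟨H, hH⟩ := hpb
  intro ε hε
  set θ : ℝ := ε / (ε + |C|)
  have hθ : 0 < θ := by positivity
  have hθ1 : θ ≤ 1 := div_le_one_of_le₀ (by simp) (by positivity)
  have hθC : θ * C ≤ ε := by
    rw [div_mul_eq_mul_div, div_le_iff₀ (by positivity)]
    nlinarith [le_abs_self C]
  refine ⟨θ ^ H * ρ, by positivity, fun i S y hy => ?_⟩
  have hscaled : ∑ k ∈ S, ‖(θ⁻¹ : 𝕜) * y k‖ ^ p k ≤ ρ := by
    rw [← inv_mul_le_iff₀ (by positivity)] at hy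
    refine le_trans ?_ hy
    rw [mul_sum]
    refine sum_le_sum fun k _ => ?_
    rw [norm_mul, norm_inv, RCLike.norm_ofReal, abs_of_pos hθ,
      Real.mul_rpow (by positivity) (norm_nonneg _), Real.inv_rpow hθ.le]
    gcongr ?_⁻¹ * _
    exact Real.rpow_le_rpow_of_exponent_ge hθ hθ1 (hH (Set.mem_range_self k))
  calc ∑ k ∈ S, ‖c i k * y k‖ = θ * ∑ k ∈ S, ‖c i k * ((θ⁻¹ : 𝕜) * y k)‖ := by
        rw [mul_sum]
        refine sum_congr rfl fun k _ => ?_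
        rw [mul_left_comm, norm_mul (θ⁻¹ : 𝕜), norm_inv, RCLike.norm_ofReal, abs_of_pos hθ,
          mul_inv_cancel_left₀ hθ.ne']
    _ ≤ θ * C := by
        gcongr
        exact sum_norm_mul_le_of_norm_sum_mul_le (h i S) hscaled
    _ ≤ ε := hθC

lemma single_mem_maddoxL (hp : ∀ k, 0 < p k) (k : ℕ) : (Pi.single k 1 : ℕ → 𝕜) ∈ maddoxL p :=
  summable_of_ne_finset_zero (s := {k}) fun j hj => by
    rw [Pi.single_eq_of_ne (notMem_singleton.1 hj), norm_zero, Real.zero_rpow (hp j).ne']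

lemma tsum_mul_single (c : ℕ → 𝕜) (k : ℕ) :
    ∑' j, c j * (Pi.single k 1 : ℕ → 𝕜) j = c k := by
  simp only [Pi.single_apply, mul_ite, mul_one, mul_zero, tsum_ite_eq]

lemma exists_sum_norm_rpow_le {y : ℕ → 𝕜} (hy : y ∈ maddoxL p) {ρ : ℝ} (hρ : 0 < ρ) :
    ∃ S : Finset ℕ, ∀ T : Finset ℕ, Disjoint T S → ∑ k ∈ T, ‖y k‖ ^ p k ≤ ρ := by
  obtain ⟨S, hS⟩ := summable_iff_vanishing_norm.1 hy ρ hρ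
  exact ⟨S, fun T hT => (le_abs_self _).trans (hS T hT).le⟩

namespace EquicontinuousAtZero

variable {y : ℕ → 𝕜}

lemma of_tendsto (hc : EquicontinuousAtZero p c) {l : Filter ι} [l.NeBot] {α : ℕ → 𝕜}
    (hα : ∀ k, Tendsto (c · k) l (𝓝 (α k))) : EquicontinuousAtZero p fun _ : Unit => α := by
  intro ε hε
  obtain ⟨ρ, hρ, h⟩ := hc ε hε
  refine ⟨ρ, hρ, fun _ S y hy => ?_⟩
  exact le_of_tendsto' (tendsto_finsetSum S fun k _ => ((hα k).mul_const (y k)).norm)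
    fun i => h i S y hy

lemma exists_tail_le (hc : EquicontinuousAtZero p c) (hy : y ∈ maddoxL p) {ε : ℝ} (hε : 0 < ε) :
    ∃ S : Finset ℕ, ∀ i, ∀ T : Finset ℕ, Disjoint T S → ∑ k ∈ T, ‖c i k * y k‖ ≤ ε := by
  obtain ⟨ρ, hρ, h⟩ := hc ε hε
  obtain ⟨S, hS⟩ := exists_sum_norm_rpow_le hy hρ
  exact ⟨S, fun i T hT => h i T y (hS T hT)⟩

lemma summable (hc : EquicontinuousAtZero p c) (hy : y ∈ maddoxL p) (i : ι) :
    Summable fun k => c i k * y k :=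
  let ⟨_, hS⟩ := hc.exists_tail_le hy one_pos
  .of_norm (summable_norm_of_tail (hS i))

lemma tendsto_tsum (hc : EquicontinuousAtZero p c) (hy : y ∈ maddoxL p) {l : Filter ι} [l.NeBot]
    {α : ℕ → 𝕜} (hα : ∀ k, Tendsto (c · k) l (𝓝 (α k))) :
    Tendsto (fun i => ∑' k, c i k * y k) l (𝓝 (∑' k, α k * y k)) :=
  tendsto_tsum_of_tail (fun k => (hα k).mul_const (y k)) fun _ hε =>
    let ⟨S, hS⟩ := hc.exists_tail_le hy hε
    ⟨S, Eventually.of_forall hS⟩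

lemma exists_norm_rpow_le (hc : EquicontinuousAtZero p c) (hp : ∀ k, 0 < p k) :
    ∃ M, ∀ i k, ‖c i k‖ ^ p k ≤ M := by
  obtain ⟨ρ, hρ, h⟩ := hc 1 one_pos
  refine ⟨ρ⁻¹, fun i k => ?_⟩
  have hnorm : ‖((ρ ^ (p k)⁻¹ : ℝ) : 𝕜)‖ = ρ ^ (p k)⁻¹ :=
    RCLike.norm_of_nonneg (by positivity)
  have hρk : (ρ ^ (p k)⁻¹) ^ p k = ρ := Real.rpow_inv_rpow hρ.le (hp k).ne'
  have htest := h i {k} (fun _ => ((ρ ^ (p k)⁻¹ : ℝ) : 𝕜)) (by rw [sum_singleton, hnorm, hρk])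
  rw [sum_singleton, norm_mul, hnorm] at htest
  have hpow := Real.rpow_le_one (by positivity) htest (hp k).le
  rwa [Real.mul_rpow (norm_nonneg _) (by positivity), hρk, ← le_div_iff₀ hρ, one_div] at hpow

lemma exists_norm_tsum_le (hc : EquicontinuousAtZero p c) (hp : ∀ k, 0 < p k)
    (hy : y ∈ maddoxL p) : ∃ B, ∀ i, ‖∑' k, c i k * y k‖ ≤ B := by
  obtain ⟨M, hM⟩ := hc.exists_norm_rpow_le hp
  have hcolumn : ∀ i k, ‖c i k‖ ≤ M ^ (p k)⁻¹ := fun i k => by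
    rw [← Real.rpow_rpow_inv (norm_nonneg (c i k)) (hp k).ne']
    exact Real.rpow_le_rpow (by positivity) (hM i k) (inv_nonneg.2 (hp k).le)
  obtain ⟨S, hS⟩ := hc.exists_tail_le hy one_pos
  refine ⟨∑ k ∈ S, M ^ (p k)⁻¹ * ‖y k‖ + 1, fun i => ?_⟩
  calc ‖∑' k, c i k * y k‖
      ≤ ‖∑ k ∈ S, c i k * y k‖ + ‖∑' k, c i k * y k - ∑ k ∈ S, c i k * y k‖ := norm_le_insert' _ _
    _ ≤ ∑ k ∈ S, M ^ (p k)⁻¹ * ‖y k‖ + 1 := by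
        gcongr
        · refine (norm_sum_le _ _).trans (sum_le_sum fun k _ => ?_)
          rw [norm_mul]
          exact mul_le_mul_of_nonneg_right (hcolumn i k) (norm_nonneg _)
        · exact norm_tsum_sub_sum_le (hS i)

end EquicontinuousAtZero

end Equicontinuity

section UniformBoundedness

/-- The Mazur map `z ↦ ‖z‖ ^ (q - 1) • z`, a homeomorphism for `q > 0` with inverse
`mazurMap q⁻¹`. Applied coordinatewise it identifies `l(p)` with `ℓ¹`. -/
noncomputable def mazurMap {V : Type*} [NormedAddCommGroup V] [NormedSpace ℝ V] (q : ℝ) (z : V) :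
    V :=
  ‖z‖ ^ (q - 1) • z

section MazurMap

variable {V : Type*} [NormedAddCommGroup V] [NormedSpace ℝ V] {q : ℝ}

lemma norm_mazurMap (hq : q ≠ 0) (z : V) : ‖mazurMap q z‖ = ‖z‖ ^ q := by
  rcases eq_or_ne z 0 with rfl | hz
  · rw [mazurMap, smul_zero, norm_zero, Real.zero_rpow hq]
  · rw [mazurMap, norm_smul, Real.norm_of_nonneg (by positivity),
      ← Real.rpow_add_one (norm_ne_zero_iff.2 hz), sub_add_cancel]

lemma mazurMap_inv_mazurMap (hq : q ≠ 0) (z : V) : mazurMap q⁻¹ (mazurMap q z) = z := by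
  rcases eq_or_ne z 0 with rfl | hz
  · simp only [mazurMap, smul_zero]
  · have hexp : q * (q⁻¹ - 1) + (q - 1) = 0 := by field_simp; ring
    rw [mazurMap, norm_mazurMap hq, mazurMap, smul_smul, ← Real.rpow_mul (norm_nonneg z),
      ← Real.rpow_add (norm_pos_iff.2 hz), hexp, Real.rpow_zero, one_smul]

lemma continuous_mazurMap (hq : 0 < q) : Continuous (mazurMap q : V → V) := by
  refine continuous_iff_continuousAt.2 fun z => ?_
  rcases eq_or_ne z 0 with rfl | hz
  · have hzero : mazurMap q (0 : V) = 0 := smul_zero _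
    rw [ContinuousAt, hzero, tendsto_zero_iff_norm_tendsto_zero]
    simp only [norm_mazurMap hq.ne']
    simpa only [norm_zero, Real.zero_rpow hq.ne'] using
      (continuous_norm.tendsto (0 : V)).rpow_const (.inr hq.le)
  · exact (continuousAt_id.norm.rpow_const (.inl (norm_ne_zero_iff.2 hz))).smul continuousAt_id

end MazurMap

variable {𝕜 : Type*} [RCLike 𝕜] {ι : Type*} {p : ℕ → ℝ}

/-- The functional `y ↦ ∑' k, c k * y k` on `l(p)`, transported to `ℓ¹` by the Mazur map. -/
noncomputable def pairing (p : ℕ → ℝ) (c : ℕ → 𝕜) (z : lp (fun _ : ℕ => 𝕜) 1) : 𝕜 :=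
  ∑' k, c k * mazurMap (p k)⁻¹ (z k)

lemma sum_norm_le_norm (z : lp (fun _ : ℕ => 𝕜) 1) (S : Finset ℕ) : ∑ k ∈ S, ‖z k‖ ≤ ‖z‖ := by
  simpa using lp.sum_rpow_le_norm_rpow (by simp) z S

lemma summable_norm (z : lp (fun _ : ℕ => 𝕜) 1) : Summable fun k => ‖z k‖ :=
  summable_of_sum_le (fun _ => norm_nonneg _) (sum_norm_le_norm z)

lemma mazurMap_mem_maddoxL (hp : ∀ k, 0 < p k) (z : lp (fun _ : ℕ => 𝕜) 1) :
    (fun k => mazurMap (p k)⁻¹ (z k)) ∈ maddoxL p :=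
  (summable_norm z).congr fun k => by
    rw [norm_mazurMap (inv_ne_zero (hp k).ne'), Real.rpow_inv_rpow (norm_nonneg _) (hp k).ne']

lemma pairing_sum_single (p : ℕ → ℝ) (c v : ℕ → 𝕜) (S : Finset ℕ) :
    pairing p c (∑ k ∈ S, lp.single 1 k (v k)) = ∑ k ∈ S, c k * mazurMap (p k)⁻¹ (v k) := by
  have hcoord : ∀ k, (∑ j ∈ S, lp.single 1 j (v j) : lp (fun _ : ℕ => 𝕜) 1) k =
      if k ∈ S then v k else 0 := fun k => by
    simp only [lp.coeFn_sum, Finset.sum_apply, lp.coeFn_single, sum_pi_single]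
  rw [pairing, tsum_eq_sum fun k hk => ?_]
  · exact sum_congr rfl fun k hk => by rw [hcoord, if_pos hk]
  · rw [hcoord, if_neg hk, mazurMap, smul_zero, mul_zero]

lemma continuous_mazurMap_coord (hp : ∀ k, 0 < p k) (k : ℕ) :
    Continuous fun z : lp (fun _ : ℕ => 𝕜) 1 => mazurMap (p k)⁻¹ (z k) :=
  (continuous_mazurMap (inv_pos.2 (hp k))).comp
    ((continuous_apply k).comp lp.uniformContinuous_coe.continuous)

lemma continuous_pairing_of_eq_zero (hp : ∀ k, 0 < p k) {c : ℕ → 𝕜} {m : ℕ}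
    (hc : ∀ k, m < k → c k = 0) : Continuous (pairing p c) := by
  have hfin : pairing p c = fun z => ∑ k ∈ range (m + 1), c k * mazurMap (p k)⁻¹ (z k) :=
    funext fun z => tsum_eq_sum fun k hk => by rw [hc k (by simpa using hk), zero_mul]
  rw [hfin]
  exact continuous_finsetSum _ fun k _ => continuous_const.mul (continuous_mazurMap_coord hp k)

lemma EquicontinuousAtZero.continuous_pairing (hp : ∀ k, 0 < p k) {c : ι → ℕ → 𝕜}
    (hc : EquicontinuousAtZero p c) (i : ι) : Continuous (pairing p (c i)) := by
  refine continuous_iff_continuousAt.2 fun z₀ => tendsto_tsum_of_tail (fun k => ?_) fun ε hε => ?_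
  · exact ((continuous_mazurMap_coord hp k).tendsto z₀).const_mul (c i k)
  obtain ⟨ρ, hρ, h⟩ := hc ε hε
  obtain ⟨S, hS⟩ := summable_iff_vanishing_norm.1 (summable_norm z₀) (ρ / 2) (half_pos hρ)
  refine ⟨S, ?_⟩
  filter_upwards [Metric.ball_mem_nhds z₀ (half_pos hρ)] with z hz T hT
  refine h i T _ ?_
  calc ∑ k ∈ T, ‖mazurMap (p k)⁻¹ (z k)‖ ^ p k
      = ∑ k ∈ T, ‖z₀ k + (z - z₀) k‖ := sum_congr rfl fun k _ => by
        rw [norm_mazurMap (inv_ne_zero (hp k).ne'), Real.rpow_inv_rpow (norm_nonneg _) (hp k).ne',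
          lp.coeFn_sub, Pi.sub_apply, add_sub_cancel]
    _ ≤ ∑ k ∈ T, ‖z₀ k‖ + ∑ k ∈ T, ‖(z - z₀) k‖ := by
        rw [← sum_add_distrib]
        exact sum_le_sum fun k _ => norm_add_le _ _
    _ ≤ ρ / 2 + ρ / 2 := by
        gcongr
        · exact (le_abs_self _).trans (hS T hT).le
        · exact (sum_norm_le_norm _ T).trans (mem_ball_iff_norm.1 hz).le
    _ = ρ := add_halves ρ

/-- Since `l(p)` is homeomorphic to the Baire space `ℓ¹`, a pointwise bounded family of functionals
is bounded on a neighbourhood of some finitely supported sequence. -/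
lemma exists_norm_pairing_le {c : ι → ℕ → 𝕜} (hp : ∀ k, 0 < p k)
    (hcont : ∀ i, Continuous (pairing p (c i)))
    (hb : ∀ y ∈ maddoxL p, ∃ B, ∀ i, ‖∑' k, c i k * y k‖ ≤ B) :
    ∃ (S₀ : Finset ℕ) (v : ℕ → 𝕜) (B ρ : ℝ), 0 < ρ ∧ ∀ i (w : lp (fun _ : ℕ => 𝕜) 1), ‖w‖ ≤ ρ →
      ‖pairing p (c i) (∑ k ∈ S₀, lp.single 1 k (v k) + w)‖ ≤ B := by
  have hcover : ⋃ B : ℕ, {z | ∀ i, ‖pairing p (c i) z‖ ≤ B} = Set.univ :=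
    Set.eq_univ_of_forall fun z => by
      obtain ⟨B, hB⟩ := hb _ (mazurMap_mem_maddoxL hp z)
      obtain ⟨N, hN⟩ := exists_nat_ge B
      exact Set.mem_iUnion.2 ⟨N, fun i => (hB i).trans hN⟩
  have hclosed : ∀ B : ℕ, IsClosed {z | ∀ i, ‖pairing p (c i) z‖ ≤ B} := fun B => by
    simp only [Set.ofPred_forall]
    exact isClosed_iInter fun i => isClosed_le (hcont i).norm continuous_const
  obtain ⟨B, z, hz⟩ := nonempty_interior_of_iUnion_of_closed hclosed hcover
  obtain ⟨S₀, hS₀⟩ :=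
    ((lp.hasSum_single ENNReal.one_ne_top z).eventually_mem (isOpen_interior.mem_nhds hz)).exists
  obtain ⟨ρ, hρ, hball⟩ := Metric.mem_nhds_iff.1 (mem_interior_iff_mem_nhds.1 hS₀)
  refine ⟨S₀, z, B, ρ / 2, half_pos hρ, fun i w hw => hball ?_ i⟩
  rw [mem_ball_iff_norm, add_sub_cancel_left]
  exact hw.trans_lt (half_lt_self hρ)

lemma exists_norm_apply_le {c : ι → ℕ → 𝕜} (hp : ∀ k, 0 < p k)
    (hb : ∀ y ∈ maddoxL p, ∃ B, ∀ i, ‖∑' k, c i k * y k‖ ≤ B) (k : ℕ) :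
    ∃ B, ∀ i, ‖c i k‖ ≤ B := by
  simpa only [tsum_mul_single] using hb _ (single_mem_maddoxL hp k)

lemma norm_sum_mul_le_of_norm_pairing_le (hp : ∀ k, 0 < p k) {c v : ℕ → 𝕜} {S₀ : Finset ℕ}
    {B ρ : ℝ} (hρ : 0 < ρ) (hB : ∀ w : lp (fun _ : ℕ => 𝕜) 1, ‖w‖ ≤ ρ →
      ‖pairing p c (∑ k ∈ S₀, lp.single 1 k (v k) + w)‖ ≤ B)
    {T : Finset ℕ} (hT : Disjoint S₀ T) {y : ℕ → 𝕜} (hy : ∑ k ∈ T, ‖y k‖ ^ p k ≤ ρ) :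
    ‖∑ k ∈ T, c k * y k‖ ≤ B + B := by
  set u : ℕ → 𝕜 := S₀.piecewise v fun k => mazurMap (p k) (y k)
  have hu₀ : ∀ k ∈ S₀, u k = v k := fun k hk => piecewise_eq_of_mem _ _ _ hk
  have hu : ∀ k ∈ T, u k = mazurMap (p k) (y k) := fun k hk =>
    piecewise_eq_of_notMem _ _ _ (disjoint_right.1 hT hk)
  have hw : ‖∑ k ∈ T, lp.single 1 k (u k)‖ ≤ ρ := by
    have hnorm := lp.norm_sum_single (p := 1) (by simp) u T
    simp only [ENNReal.toReal_one, Real.rpow_one] at hnorm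
    rwa [hnorm, sum_congr rfl fun k hk => by rw [hu k hk, norm_mazurMap (hp k).ne']]
  have hdiff : ∑ k ∈ T, c k * y k =
      pairing p c (∑ k ∈ S₀, lp.single 1 k (u k) + ∑ k ∈ T, lp.single 1 k (u k)) -
        pairing p c (∑ k ∈ S₀, lp.single 1 k (u k) + 0) := by
    rw [add_zero, ← sum_union hT, pairing_sum_single, pairing_sum_single, sum_union hT,
      add_sub_cancel_left]
    exact sum_congr rfl fun k hk => by rw [hu k hk, mazurMap_inv_mazurMap (hp k).ne']
  rw [hdiff, sum_congr rfl fun k hk => by rw [hu₀ k hk]]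
  exact norm_sub_le_of_le (hB _ hw) (hB 0 (by simpa only [norm_zero] using hρ.le))

lemma norm_sum_inter_mul_le (hp : ∀ k, 0 < p k) {c y : ℕ → 𝕜} {C : ℕ → ℝ}
    (hC : ∀ k, ‖c k‖ ≤ C k) {S : Finset ℕ} {ρ : ℝ} (hy : ∑ k ∈ S, ‖y k‖ ^ p k ≤ ρ)
    (S₀ : Finset ℕ) : ‖∑ k ∈ S ∩ S₀, c k * y k‖ ≤ ∑ k ∈ S₀, C k * ρ ^ (p k)⁻¹ := by
  have hρ : 0 ≤ ρ := (sum_nonneg fun k _ => by positivity).trans hy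
  have hC₀ : ∀ k, 0 ≤ C k := fun k => (norm_nonneg _).trans (hC k)
  have hcoord : ∀ k ∈ S ∩ S₀, ‖c k * y k‖ ≤ C k * ρ ^ (p k)⁻¹ := fun k hk => by
    have hyk : ‖y k‖ ^ p k ≤ ρ :=
      (single_le_sum (fun j _ => by positivity) (mem_inter.1 hk).1).trans hy
    rw [norm_mul]
    exact mul_le_mul (hC k) ((Real.le_rpow_inv_iff_of_pos (norm_nonneg _) hρ (hp k)).2 hyk)
      (norm_nonneg _) (hC₀ k)
  calc ‖∑ k ∈ S ∩ S₀, c k * y k‖ ≤ ∑ k ∈ S ∩ S₀, C k * ρ ^ (p k)⁻¹ := norm_sum_le_of_le _ hcoord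
    _ ≤ ∑ k ∈ S₀, C k * ρ ^ (p k)⁻¹ :=
      sum_le_sum_of_subset_of_nonneg inter_subset_right fun k _ _ =>
        mul_nonneg (hC₀ k) (by positivity)

lemma equicontinuousAtZero_of_pointwise_bounded {c : ι → ℕ → 𝕜} (hp : ∀ k, 0 < p k)
    (hpb : BddAbove (Set.range p)) (hcont : ∀ i, Continuous (pairing p (c i)))
    (hb : ∀ y ∈ maddoxL p, ∃ B, ∀ i, ‖∑' k, c i k * y k‖ ≤ B) :
    EquicontinuousAtZero p c := by
  obtain ⟨S₀, v, B, ρ, hρ, hB⟩ := exists_norm_pairing_le hp hcont hb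
  choose C hC using exists_norm_apply_le hp hb
  refine equicontinuousAtZero_of_norm_sum_le hpb hρ
    (C := ∑ k ∈ S₀, C k * ρ ^ (p k)⁻¹ + (B + B)) fun i S y hy => ?_
  have hy_sdiff : ∑ k ∈ S \ S₀, ‖y k‖ ^ p k ≤ ρ :=
    (sum_le_sum_of_subset_of_nonneg sdiff_subset fun _ _ _ => by positivity).trans hy
  rw [← sum_inter_add_sum_sdiff S S₀]
  exact norm_add_le_of_le (norm_sum_inter_mul_le hp (fun k => hC k i) hy S₀)
    (norm_sum_mul_le_of_norm_pairing_le hp hρ (hB i) disjoint_sdiff hy_sdiff)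

end UniformBoundedness

section Conditions

lemma iSup_ofReal_lt_top_iff {ι : Sort*} {g : ι → ℝ} :
    (⨆ i, ENNReal.ofReal (g i)) < ⊤ ↔ ∃ M, ∀ i, g i ≤ M := by
  constructor
  · intro h
    refine ⟨(⨆ i, ENNReal.ofReal (g i)).toReal, fun i => ?_⟩
    rw [← ENNReal.ofReal_le_iff_le_toReal h.ne]
    exact le_iSup (fun i => ENNReal.ofReal (g i)) i
  · rintro ⟨M, hM⟩
    exact (iSup_le fun i => ENNReal.ofReal_le_ofReal (hM i)).trans_lt ENNReal.ofReal_lt_top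

lemma iSup_iSup_ofReal_lt_top_iff {ι κ : Type*} {g : ι → κ → ℝ} :
    (⨆ i, ⨆ k, ENNReal.ofReal (g i k)) < ⊤ ↔ ∃ M, ∀ i k, g i k ≤ M := by
  rw [← iSup_prod (f := fun q : ι × κ => ENNReal.ofReal (g q.1 q.2)), iSup_ofReal_lt_top_iff]
  simp only [Prod.forall]

lemma iSup_tsum_ofReal_lt_top_iff {ι κ : Type*} {g : ι → κ → ℝ} (hg : ∀ i k, 0 ≤ g i k) :
    (⨆ i, ∑' k, ENNReal.ofReal (g i k)) < ⊤ ↔ ∃ M, ∀ i (S : Finset κ), ∑ k ∈ S, g i k ≤ M := by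
  simp only [ENNReal.tsum_eq_iSup_sum, ← ENNReal.ofReal_sum_of_nonneg fun k _ => hg _ k,
    iSup_iSup_ofReal_lt_top_iff]

/-- Tested on `y = (ρ / σ) u ^ (q - 1)`, where `q = conjExp p` and `σ = ∑ u ^ q`. -/
lemma sum_rpow_conjExp_le {κ : Type*} {p u : κ → ℝ} {S : Finset κ} {ρ : ℝ} (hp : ∀ k, 1 < p k)
    (hu : ∀ k, 0 ≤ u k) (hρ : 0 < ρ)
    (h : ∀ y : κ → ℝ, (∀ k, 0 ≤ y k) → ∑ k ∈ S, y k ^ p k ≤ ρ → ∑ k ∈ S, u k * y k < ρ) :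
    ∑ k ∈ S, u k ^ conjExp (p k) ≤ ρ := by
  have hconj : ∀ k, conjExp (p k) ≠ 0 ∧ (conjExp (p k) - 1) * p k = conjExp (p k) := fun k => by
    have hpk : p k - 1 ≠ 0 := sub_ne_zero.2 (hp k).ne'
    refine ⟨div_ne_zero (zero_lt_one.trans (hp k)).ne' hpk, ?_⟩
    rw [conjExp]
    field_simp
    ring
  set σ := ∑ k ∈ S, u k ^ conjExp (p k)
  by_contra! hσ
  have hσ₀ : 0 < σ := hρ.trans hσ
  refine (h (fun k => ρ / σ * u k ^ (conjExp (p k) - 1)) (fun k => ?_) ?_).ne ?_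
  · exact mul_nonneg (by positivity) (Real.rpow_nonneg (hu k) _)
  · calc ∑ k ∈ S, (ρ / σ * u k ^ (conjExp (p k) - 1)) ^ p k
        ≤ ∑ k ∈ S, ρ / σ * u k ^ conjExp (p k) := by
          refine sum_le_sum fun k _ => ?_
          rw [Real.mul_rpow (by positivity) (Real.rpow_nonneg (hu k) _), ← Real.rpow_mul (hu k),
            (hconj k).2]
          gcongr
          · exact Real.rpow_nonneg (hu k) _
          · exact Real.rpow_le_self_of_le_one (by positivity) ((div_le_one hσ₀).2 hσ.le) (hp k).le
      _ = ρ := by rw [← mul_sum, div_mul_cancel₀ _ hσ₀.ne']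
  · calc ∑ k ∈ S, u k * (ρ / σ * u k ^ (conjExp (p k) - 1))
        = ∑ k ∈ S, ρ / σ * u k ^ conjExp (p k) := by
          refine sum_congr rfl fun k _ => ?_
          rw [mul_left_comm, ← Real.rpow_one_add' (hu k) (by simpa using (hconj k).1),
            add_sub_cancel]
      _ = ρ := by rw [← mul_sum, div_mul_cancel₀ _ hσ₀.ne']

lemma mul_le_rpow_conjExp_add_rpow {q a b : ℝ} (hq : 1 < q) (ha : 0 ≤ a) (hb : 0 ≤ b) :
    a * b ≤ a ^ conjExp q + b ^ q := by
  have hconj : (conjExp q).HolderConjugate q := (Real.HolderConjugate.conjExponent hq).symm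
  refine (Real.young_inequality_of_nonneg ha hb hconj).trans (add_le_add ?_ ?_)
  · exact div_le_self (Real.rpow_nonneg ha _) hconj.lt.le
  · exact div_le_self (Real.rpow_nonneg hb _) hq.le

variable {𝕜 : Type*} [RCLike 𝕜] {ι : Type*} {p : ℕ → ℝ} {c : ι → ℕ → 𝕜}

lemma EquicontinuousAtZero.exists_sum_rpow_conjExp_le (hc : EquicontinuousAtZero p c)
    (hp1 : ∀ k, 1 < p k) : ∃ L : ℕ, 0 < L ∧
      ∃ M, ∀ i (S : Finset ℕ), ∑ k ∈ S, (‖c i k‖ * (L : ℝ)⁻¹) ^ conjExp (p k) ≤ M := by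
  obtain ⟨ρ, hρ, h⟩ := hc 1 one_pos
  obtain ⟨L, hL⟩ := exists_nat_gt ρ⁻¹
  have hL₀ : (0 : ℝ) < L := (inv_pos.2 hρ).trans hL
  refine ⟨L, Nat.cast_pos.1 hL₀, ρ, fun i S => ?_⟩
  refine sum_rpow_conjExp_le hp1 (fun k => by positivity) hρ fun y hy₀ hy => ?_
  have hnorm : ∀ k, ‖(y k : 𝕜)‖ = y k := fun k => RCLike.norm_of_nonneg (hy₀ k)
  have hbound := h i S (fun k => (y k : 𝕜)) (by simpa only [hnorm])
  simp only [norm_mul, hnorm] at hbound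
  calc ∑ k ∈ S, ‖c i k‖ * (L : ℝ)⁻¹ * y k = (L : ℝ)⁻¹ * ∑ k ∈ S, ‖c i k‖ * y k := by
        rw [mul_sum]
        exact sum_congr rfl fun k _ => by ring
    _ ≤ (L : ℝ)⁻¹ := mul_le_of_le_one_right (by positivity) hbound
    _ < ρ := inv_lt_of_inv_lt₀ hρ hL

lemma equicontinuousAtZero_of_sum_rpow_conjExp_le (hpb : BddAbove (Set.range p))
    (hp1 : ∀ k, 1 < p k) {L M : ℝ} (hL : 0 < L)
    (hM : ∀ i (S : Finset ℕ), ∑ k ∈ S, (‖c i k‖ * L⁻¹) ^ conjExp (p k) ≤ M) :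
    EquicontinuousAtZero p c := by
  refine equicontinuousAtZero_of_norm_sum_le hpb one_pos (C := L * (M + 1)) fun i S y hy => ?_
  calc ‖∑ k ∈ S, c i k * y k‖ ≤ ∑ k ∈ S, L * (‖c i k‖ * L⁻¹ * ‖y k‖) := by
        refine norm_sum_le_of_le _ fun k _ => le_of_eq ?_
        rw [norm_mul]
        field_simp
    _ ≤ ∑ k ∈ S, L * ((‖c i k‖ * L⁻¹) ^ conjExp (p k) + ‖y k‖ ^ p k) := by
        gcongr with k
        exact mul_le_rpow_conjExp_add_rpow (hp1 k) (by positivity) (norm_nonneg _)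
    _ ≤ L * (M + 1) := by
        rw [← mul_sum, sum_add_distrib]
        gcongr
        exact hM i S

lemma equicontinuousAtZero_iff_of_one_lt (hpb : BddAbove (Set.range p)) (hp1 : ∀ k, 1 < p k) :
    EquicontinuousAtZero p c ↔ ∃ L : ℕ, 0 < L ∧
      (⨆ i, ∑' k, ENNReal.ofReal (‖c i k * (L : 𝕜)⁻¹‖ ^ conjExp (p k))) < ⊤ := by
  have hbounded : ∀ L : ℕ,
      (⨆ i, ∑' k, ENNReal.ofReal (‖c i k * (L : 𝕜)⁻¹‖ ^ conjExp (p k))) < ⊤ ↔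
        ∃ M, ∀ i (S : Finset ℕ), ∑ k ∈ S, (‖c i k‖ * (L : ℝ)⁻¹) ^ conjExp (p k) ≤ M := fun L => by
    rw [iSup_tsum_ofReal_lt_top_iff fun i k => Real.rpow_nonneg (norm_nonneg _) _]
    simp only [norm_mul, norm_inv, RCLike.norm_natCast]
  simp only [hbounded]
  exact ⟨fun hc => hc.exists_sum_rpow_conjExp_le hp1, fun ⟨_, hL, _, hM⟩ =>
    equicontinuousAtZero_of_sum_rpow_conjExp_le hpb hp1 (Nat.cast_pos.2 hL) hM⟩

lemma equicontinuousAtZero_iff_of_le_one (hp : ∀ k, 0 < p k) (hp1 : ∀ k, p k ≤ 1) :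
    EquicontinuousAtZero p c ↔ (⨆ i, ⨆ k, ENNReal.ofReal (‖c i k‖ ^ p k)) < ⊤ := by
  rw [iSup_iSup_ofReal_lt_top_iff]
  refine ⟨fun hc => hc.exists_norm_rpow_le hp, fun ⟨M, hM⟩ => ?_⟩
  have hpb : BddAbove (Set.range p) := ⟨1, Set.forall_mem_range.2 hp1⟩
  set N := |M| + 1
  have hN : 0 < N := by positivity
  have hmul : ∀ i k (z : 𝕜), ‖c i k * z‖ ^ p k ≤ N * ‖z‖ ^ p k := fun i k z => by
    rw [norm_mul, Real.mul_rpow (norm_nonneg _) (norm_nonneg _)]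
    gcongr
    exact (hM i k).trans ((le_abs_self M).trans (le_add_of_nonneg_right zero_le_one))
  refine equicontinuousAtZero_of_norm_sum_le hpb (inv_pos.2 hN) (C := 1) fun i S y hy => ?_
  have hsum : ∑ k ∈ S, ‖c i k * y k‖ ^ p k ≤ 1 := by
    calc ∑ k ∈ S, ‖c i k * y k‖ ^ p k ≤ N * ∑ k ∈ S, ‖y k‖ ^ p k := by
          rw [mul_sum]
          exact sum_le_sum fun k _ => hmul i k (y k)
      _ ≤ N * N⁻¹ := by gcongr
      _ = 1 := mul_inv_cancel₀ hN.ne'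
  refine (norm_sum_le_of_le _ fun k hk => ?_).trans hsum
  have hle : ‖c i k * y k‖ ^ p k ≤ 1 := (single_le_sum (fun _ _ => by positivity) hk).trans hsum
  have hle_one : ‖c i k * y k‖ ≤ 1 :=
    le_of_not_gt fun hlt => (Real.one_lt_rpow hlt (hp k)).not_ge hle
  exact Real.self_le_rpow_of_le_one (norm_nonneg _) hle_one (hp1 k)

lemma exists_mul_rpow_le (hp : ∀ k, 0 < p k) (hpb : BddAbove (Set.range p)) {g : ι → ℕ → ℝ}
    (hg : ∀ i k, 0 ≤ g i k) (hM : ∃ M, ∀ i k, g i k ^ p k ≤ M) {b : ℝ} (hb : 0 ≤ b) :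
    ∃ M, ∀ i k, (b * g i k) ^ p k ≤ M := by
  obtain ⟨M, hM⟩ := hM
  obtain ⟨H, hH⟩ := hpb
  refine ⟨max b 1 ^ H * M, fun i k => ?_⟩
  rw [Real.mul_rpow hb (hg i k)]
  refine mul_le_mul ?_ (hM i k) (Real.rpow_nonneg (hg i k) _) (by positivity)
  calc b ^ p k ≤ max b 1 ^ p k := Real.rpow_le_rpow hb (le_max_left b 1) (hp k).le
    _ ≤ max b 1 ^ H :=
      Real.rpow_le_rpow_of_exponent_le (le_max_right b 1) (hH (Set.mem_range_self k))

variable {r s t : ℕ → 𝕜}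

lemma setB5_subset_setB3 (hs : s 0 ≠ 0) (hp : ∀ k, 0 < p k) (hpb : BddAbove (Set.range p)) :
    setB5 r s t p ⊆ setB3 r t p := by
  intro a ha
  obtain ⟨M, hM⟩ := exists_mul_rpow_le hp hpb (fun _ _ => norm_nonneg _)
    (iSup_iSup_ofReal_lt_top_iff.1 ha) (norm_nonneg (s 0))
  refine iSup_ofReal_lt_top_iff.2 ⟨M, fun k => ?_⟩
  simpa only [← norm_mul, E_self, mul_inv_cancel_left₀ hs] using hM k k

lemma setB5_subset_setB7 (hp : ∀ k, 0 < p k) (hpb : BddAbove (Set.range p)) :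
    setB5 r s t p ⊆ setB7 r s t p := by
  refine fun a ha L _ => ⟨0, iSup_iSup_ofReal_lt_top_iff.2 ?_⟩
  simpa only [Pi.zero_apply, sub_zero, mul_comm] using exists_mul_rpow_le hp hpb
    (fun _ _ => norm_nonneg _) (iSup_iSup_ofReal_lt_top_iff.1 ha) L.cast_nonneg

end Conditions

section Duality

variable {𝕜 : Type*} [RCLike 𝕜] {r s t : ℕ → 𝕜} {p : ℕ → ℝ}

lemma EquicontinuousAtZero.seriesConvTo (hr : ∀ n, r n ≠ 0) (hs : s 0 ≠ 0) (ht : ∀ n, t n ≠ 0)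
    {a α x : ℕ → 𝕜} (ha : EquicontinuousAtZero p (E r s t a))
    (hα : ∀ k, Tendsto (E r s t a · k) atTop (𝓝 (α k))) (hx : x ∈ lSpace r s t p) :
    SeriesConvTo (fun k => a k * x k) (∑' k, α k * genMean r s t (diff x) k) := by
  simp only [SeriesConvTo, sum_mul_eq_tsum_E_mul hr hs ht]
  exact ha.tendsto_tsum hx hα

lemma exists_tendsto_tsum_of_mem_betaDual (hr : ∀ n, r n ≠ 0) (hs : s 0 ≠ 0) (ht : ∀ n, t n ≠ 0)
    {a y : ℕ → 𝕜} (ha : a ∈ betaDual (lSpace r s t p)) (hy : y ∈ maddoxL p) :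
    ∃ v, Tendsto (fun m => ∑' k, E r s t a m k * y k) atTop (𝓝 v) := by
  obtain ⟨x, rfl⟩ := genMean_diff_surjective hr hs ht y
  obtain ⟨v, hv⟩ := ha x hy
  exact ⟨v, by simpa only [SeriesConvTo, sum_mul_eq_tsum_E_mul hr hs ht] using hv⟩

lemma mem_betaDual_iff (hr : ∀ n, r n ≠ 0) (hs : s 0 ≠ 0) (ht : ∀ n, t n ≠ 0)
    (hp : ∀ k, 0 < p k) (hpb : BddAbove (Set.range p)) {a : ℕ → 𝕜} :
    a ∈ betaDual (lSpace r s t p) ↔ EquicontinuousAtZero p (E r s t a) ∧ a ∈ setB6 r s t := by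
  refine ⟨fun ha => ⟨?_, ?_⟩, fun ⟨ha, α, hα⟩ x hx => ⟨_, ha.seriesConvTo hr hs ht hα hx⟩⟩
  · refine equicontinuousAtZero_of_pointwise_bounded hp hpb
      (fun m => continuous_pairing_of_eq_zero hp fun k => E_of_lt r s t a) fun y hy => ?_
    obtain ⟨v, hv⟩ := exists_tendsto_tsum_of_mem_betaDual hr hs ht ha hy
    obtain ⟨B, hB⟩ := hv.norm.bddAbove_range
    exact ⟨B, Set.forall_mem_range.1 hB⟩
  · choose α hα using fun k =>
      exists_tendsto_tsum_of_mem_betaDual hr hs ht ha (single_mem_maddoxL hp k)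
    exact ⟨α, by simpa only [tsum_mul_single] using hα⟩

variable {A : ℕ → ℕ → 𝕜}

lemma tendsto_Etilde {n : ℕ} (hA : A n ∈ setB6 r s t) (k : ℕ) :
    Tendsto (E r s t (A n) · k) atTop (𝓝 (Etilde r s t A n k)) :=
  let ⟨α, hα⟩ := hA
  tendsto_nhds_limUnder ⟨α k, hα k⟩

lemma equicontinuousAtZero_Etilde (hr : ∀ n, r n ≠ 0) (hs : s 0 ≠ 0) (ht : ∀ n, t n ≠ 0)
    (hp : ∀ k, 0 < p k) (hpb : BddAbove (Set.range p)) {n : ℕ}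
    (hA : A n ∈ betaDual (lSpace r s t p)) :
    EquicontinuousAtZero p fun _ : Unit => Etilde r s t A n :=
  let ⟨hE, hB6⟩ := (mem_betaDual_iff hr hs ht hp hpb).1 hA
  hE.of_tendsto (tendsto_Etilde hB6)

lemma seriesConvTo_tsum_Etilde (hr : ∀ n, r n ≠ 0) (hs : s 0 ≠ 0) (ht : ∀ n, t n ≠ 0)
    (hp : ∀ k, 0 < p k) (hpb : BddAbove (Set.range p)) {n : ℕ}
    (hA : A n ∈ betaDual (lSpace r s t p)) {x : ℕ → 𝕜} (hx : x ∈ lSpace r s t p) :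
    SeriesConvTo (fun k => A n k * x k) (∑' k, Etilde r s t A n k * genMean r s t (diff x) k) :=
  let ⟨hE, hB6⟩ := (mem_betaDual_iff hr hs ht hp hpb).1 hA
  hE.seriesConvTo hr hs ht (tendsto_Etilde hB6) hx

lemma tsum_sum_mul {c : ℕ → ℕ → 𝕜} (hc : ∀ n, EquicontinuousAtZero p fun _ : Unit => c n)
    {y : ℕ → 𝕜} (hy : y ∈ maddoxL p) (F : Finset ℕ) :
    ∑' k, (∑ n ∈ F, c n k) * y k = ∑ n ∈ F, ∑' k, c n k * y k := by
  simp only [sum_mul]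
  exact Summable.tsum_finsetSum fun n _ => (hc n).summable hy ()

lemma continuous_pairing_sum (hp : ∀ k, 0 < p k) {c : ℕ → ℕ → 𝕜}
    (hc : ∀ n, EquicontinuousAtZero p fun _ : Unit => c n) (F : Finset ℕ) :
    Continuous (pairing p fun k => ∑ n ∈ F, c n k) := by
  have hsum : pairing p (fun k => ∑ n ∈ F, c n k) = fun z => ∑ n ∈ F, pairing p (c n) z :=
    funext fun z => tsum_sum_mul hc (mazurMap_mem_maddoxL hp z) F
  rw [hsum]
  exact continuous_finsetSum F fun n _ => (hc n).continuous_pairing hp ()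

lemma mem_betaDual_of_mem_matrixClass {U V : Set (ℕ → 𝕜)} (hA : A ∈ matrixClass U V) (n : ℕ) :
    A n ∈ betaDual U := fun x hx =>
  let ⟨z, _, hz⟩ := hA x hx
  ⟨z n, hz n⟩

lemma mem_matrixClass_iff (hr : ∀ n, r n ≠ 0) (hs : s 0 ≠ 0) (ht : ∀ n, t n ≠ 0)
    (hp : ∀ k, 0 < p k) (hpb : BddAbove (Set.range p)) :
    A ∈ matrixClass (lSpace r s t p) ell1 ↔
      EquicontinuousAtZero p (fun (F : Finset ℕ) k => ∑ n ∈ F, Etilde r s t A n k) ∧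
        ∀ n, A n ∈ betaDual (lSpace r s t p) := by
  constructor
  · intro hA
    have hrow := mem_betaDual_of_mem_matrixClass hA
    have hlim := fun n => equicontinuousAtZero_Etilde hr hs ht hp hpb (hrow n)
    refine ⟨equicontinuousAtZero_of_pointwise_bounded hp hpb (continuous_pairing_sum hp hlim)
      fun y hy => ?_, hrow⟩
    obtain ⟨x, rfl⟩ := genMean_diff_surjective hr hs ht y
    obtain ⟨z, hz, hconv⟩ := hA x hy
    have hz_eq : ∀ n, ∑' k, Etilde r s t A n k * genMean r s t (diff x) k = z n := fun n =>
      tendsto_nhds_unique (seriesConvTo_tsum_Etilde hr hs ht hp hpb (hrow n) hy) (hconv n)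
    refine ⟨∑' n, ‖z n‖, fun F => ?_⟩
    simp only [tsum_sum_mul hlim hy, hz_eq]
    exact (norm_sum_le F z).trans (hz.sum_le_tsum F fun _ _ => norm_nonneg _)
  · rintro ⟨hF, hrow⟩ x hx
    have hlim := fun n => equicontinuousAtZero_Etilde hr hs ht hp hpb (hrow n)
    refine ⟨fun n => ∑' k, Etilde r s t A n k * genMean r s t (diff x) k, ?_,
      fun n => seriesConvTo_tsum_Etilde hr hs ht hp hpb (hrow n) hx⟩
    obtain ⟨B, hB⟩ := hF.exists_norm_tsum_le hp hx
    exact mem_ell1_of_norm_sum_le fun F => by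
      rw [← tsum_sum_mul hlim hx]
      exact hB F

lemma betaDual_lSpace_subset_setB5 (hr : ∀ n, r n ≠ 0) (hs : s 0 ≠ 0) (ht : ∀ n, t n ≠ 0)
    (hp : ∀ k, 0 < p k) (hpb : BddAbove (Set.range p)) :
    betaDual (lSpace r s t p) ⊆ setB5 r s t p := fun _ ha =>
  iSup_iSup_ofReal_lt_top_iff.2
    (((mem_betaDual_iff hr hs ht hp hpb).1 ha).1.exists_norm_rpow_le hp)

lemma betaDual_lSpace_eq_of_one_lt (hr : ∀ n, r n ≠ 0) (hs : s 0 ≠ 0) (ht : ∀ n, t n ≠ 0)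
    (hpb : BddAbove (Set.range p)) (hp1 : ∀ k, 1 < p k) :
    betaDual (lSpace r s t p) = setB3 r t p ∩ setB4 r s t p ∩ setB6 r s t := by
  have hp : ∀ k, 0 < p k := fun k => one_pos.trans (hp1 k)
  have hdual : betaDual (lSpace r s t p) = setB4 r s t p ∩ setB6 r s t := Set.ext fun a =>
    (mem_betaDual_iff hr hs ht hp hpb).trans
      (and_congr_left' (equicontinuousAtZero_iff_of_one_lt hpb hp1))
  rw [Set.inter_assoc, ← hdual, Set.right_eq_inter]
  exact (betaDual_lSpace_subset_setB5 hr hs ht hp hpb).trans (setB5_subset_setB3 hs hp hpb)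

lemma betaDual_lSpace_eq_of_le_one (hr : ∀ n, r n ≠ 0) (hs : s 0 ≠ 0) (ht : ∀ n, t n ≠ 0)
    (hp : ∀ k, 0 < p k) (hp1 : ∀ k, p k ≤ 1) :
    betaDual (lSpace r s t p) =
      setB3 r t p ∩ setB5 r s t p ∩ setB6 r s t ∩ setB7 r s t p := by
  have hpb : BddAbove (Set.range p) := ⟨1, Set.forall_mem_range.2 hp1⟩
  have hdual : betaDual (lSpace r s t p) = setB5 r s t p ∩ setB6 r s t := Set.ext fun a =>
    (mem_betaDual_iff hr hs ht hp hpb).trans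
      (and_congr_left' (equicontinuousAtZero_iff_of_le_one hp hp1))
  have hsub := betaDual_lSpace_subset_setB5 hr hs ht hp hpb
  rw [Set.inter_assoc (setB3 r t p), ← hdual,
    Set.inter_eq_right.2 (hsub.trans (setB5_subset_setB3 hs hp hpb)),
    Set.inter_eq_left.2 (hsub.trans (setB5_subset_setB7 hp hpb))]

end Duality

end GenMeans

theorem theorem4p7 {𝕜 : Type*} [RCLike 𝕜] (r s t : ℕ → 𝕜) (p : ℕ → ℝ)
    (hr : ∀ n, r n ≠ 0) (ht : ∀ n, t n ≠ 0) (hs : s 0 ≠ 0)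
    (hp : ∀ k, 0 < p k) (hpb : BddAbove (Set.range p)) (A : ℕ → ℕ → 𝕜) :
    ((∀ k, 1 < p k) →
      GenMeans.betaDual (GenMeans.lSpace r s t p) =
          GenMeans.setB3 r t p ∩ GenMeans.setB4 r s t p ∩ GenMeans.setB6 r s t ∧
        (A ∈ GenMeans.matrixClass (GenMeans.lSpace r s t p) GenMeans.ell1 ↔
          (∃ L : ℕ, 0 < L ∧
            (⨆ F : Finset ℕ, ∑' k, ENNReal.ofReal
              (‖∑ n ∈ F, GenMeans.Etilde r s t A n k * (L : 𝕜)⁻¹‖ ^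
                GenMeans.conjExp (p k))) < ⊤) ∧
          ∀ n, A n ∈ GenMeans.betaDual (GenMeans.lSpace r s t p))) ∧
    ((∀ k, p k ≤ 1) →
      GenMeans.betaDual (GenMeans.lSpace r s t p) =
          GenMeans.setB3 r t p ∩ GenMeans.setB5 r s t p ∩ GenMeans.setB6 r s t ∩
            GenMeans.setB7 r s t p ∧
        (A ∈ GenMeans.matrixClass (GenMeans.lSpace r s t p) GenMeans.ell1 ↔
          ((⨆ F : Finset ℕ, ⨆ k, ENNReal.ofReal
              (‖∑ n ∈ F, GenMeans.Etilde r s t A n k‖ ^ p k)) < ⊤) ∧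
          ∀ n, A n ∈ GenMeans.betaDual (GenMeans.lSpace r s t p))) := by
  refine ⟨fun hp1 => ⟨GenMeans.betaDual_lSpace_eq_of_one_lt hr hs ht hpb hp1, ?_⟩,
    fun hp1 => ⟨GenMeans.betaDual_lSpace_eq_of_le_one hr hs ht hp hp1, ?_⟩⟩
  · simp only [GenMeans.mem_matrixClass_iff hr hs ht hp hpb, ← Finset.sum_mul,
      GenMeans.equicontinuousAtZero_iff_of_one_lt hpb hp1]
  · rw [GenMeans.mem_matrixClass_iff hr hs ht hp hpb,
      GenMeans.equicontinuousAtZero_iff_of_le_one hp hp1]
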